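/- Let $\mathbf{H}^3$ be hyperbolic $3$-space, on which $\mathrm{PSL}_2(\mathbf{C})$ acts as the group of orientation-preserving isometries. An element $g\in\mathrm{PSL}_2(\mathbf{C})$ (whose trace is defined up to sign) is *loxodromic* if $\mathrm{tr}\,g\in\mathbf{C}\setminus[-2,2]$ and *hyperbolic* if $\mathrm{tr}\,g\in\mathbf{R}\setminus[-2,2]$. A loxodromic element $g$ acts on $\mathbf{H}^3$ by translating along, and possibly rotating around, a unique geodesic line $A_g$, its axis. A lattice (discrete subgroup of finite covolume) $\Gamma\subset\mathrm{PSL}_2(\mathbf{C})$ is an *arithmetic Kleinian group* if there are a number field $k$ with exactly one complex place $v$, a quaternion algebra $B$ over $k$ ramified at all real places of $k$, and a maximal order $\mathcal{O}$ of $B$ such that some conjugate of $\Gamma$ in $\mathrm{PSL}_2(\mathbf{C})$ is commensurable with the image $\Gamma^1_{\mathcal{O}}$ in $\mathrm{PSL}_2(\mathbf{C})$ of the group $\mathcal{O}^1$ of elements of $\mathcal{O}^*$ of reduced norm $1$, under an identification $B\otimes_k k_v\cong \mathrm{M}_2(\mathbf{C})$. A *finite area, totally geodesic surface* of $\mathbf{H}^3/\Gamma$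 is the image in $\mathbf{H}^3/\Gamma$ of a totally geodesic hyperplane $P\subset\mathbf{H}^3$ such that $P/\mathrm{Stab}_\Gamma(P)$ has finite area. The closed geodesic associated to a loxodromic $\gamma\in\Gamma$ is the image of $A_\gamma$ in $\mathbf{H}^3/\Gamma$. **Proposition.** Let $\Gamma$ be an arithmetic Kleinian group and let $\gamma\in\Gamma$ be a loxodromic element. If there is no integer $n\geq 1$ such that $\gamma^n$ is hyperbolic, then the closed geodesic associated to $\gamma$ is not contained in any finite area, totally geodesic surface of $\mathbf{H}^3/\Gamma$. -/

import Mathlib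

open scoped Pointwise MatrixGroups TensorProduct NumberField ENNReal ComplexConjugate ComplexOrder
open MeasureTheory Matrix

noncomputable section

namespace HypGeod

/-! ### Hyperbolic 3-space

The hyperboloid model. The real vector space of Hermitian `2 × 2` matrices with the quadratic form
`det` is Minkowski space of signature `(1, 3)`, and hyperbolic 3-space is the sheet of `det = 1`
that consists of the positive definite matrices. -/

/-- Hyperbolic 3-space: positive definite Hermitian `2 × 2` matrices of determinant one. -/
@[ext]
structure H3 where
  mat : Matrix (Fin 2) (Fin 2) ℂ
  posDef : mat.PosDef
  det_eq_one : mat.det = 1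

namespace H3

/-- The Minkowski inner product (the polarization of `det`) of two points of the hyperboloid. -/
def form (x y : H3) : ℝ := (x.mat⁻¹ * y.mat).trace.re / 2

/-- The hyperbolic distance (curvature `-1`): `cosh d(x, y) = ⟨x, y⟩`. -/
instance : Dist H3 := ⟨fun x y => Real.arcosh (form x y)⟩

theorem dist_def (x y : H3) : dist x y = Real.arcosh (form x y) := rfl

/-- Minkowski coordinates. -/
def t (x : H3) : ℝ := ((x.mat 0 0).re + (x.mat 1 1).re) / 2
def u (x : H3) : ℝ := ((x.mat 0 0).re - (x.mat 1 1).re) / 2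
def v (x : H3) : ℝ := (x.mat 0 1).re
def w (x : H3) : ℝ := (x.mat 0 1).im

theorem mat_one_zero (x : H3) : x.mat 1 0 = conj (x.mat 0 1) :=
  (x.posDef.isHermitian.apply 1 0).symm

theorem mat_diag_im (x : H3) (i : Fin 2) : (x.mat i i).im = 0 :=
  Complex.conj_eq_iff_im.mp (x.posDef.isHermitian.apply i i)

theorem mat_diag_pos (x : H3) (i : Fin 2) : 0 < (x.mat i i).re :=
  (Complex.pos_iff.mp (x.posDef.diag_pos (i := i))).1

theorem coord_eq (x : H3) : x.t ^ 2 - x.u ^ 2 - x.v ^ 2 - x.w ^ 2 = 1 := by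
  have h := congrArg Complex.re x.det_eq_one
  rw [Matrix.det_fin_two, mat_one_zero] at h
  simp only [Complex.sub_re, Complex.mul_re, Complex.conj_re, Complex.conj_im, mat_diag_im,
    Complex.one_re] at h
  unfold t u v w
  linarith

theorem t_pos (x : H3) : 0 < x.t := by
  have h0 := mat_diag_pos x 0
  have h1 := mat_diag_pos x 1
  unfold t
  linarith

theorem form_eq (x y : H3) : form x y = x.t * y.t - x.u * y.u - x.v * y.v - x.w * y.w := by
  unfold form
  rw [Matrix.inv_def, x.det_eq_one, Matrix.adjugate_fin_two, Matrix.trace_fin_two]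
  simp only [Ring.inverse_one, one_smul, Matrix.mul_apply, Fin.sum_univ_two]
  simp [mat_one_zero, mat_diag_im]
  unfold t u v w
  ring

theorem coord_ext {x y : H3} (ht : x.t = y.t) (hu : x.u = y.u) (hv : x.v = y.v)
    (hw : x.w = y.w) : x = y := by
  have h00 : x.mat 0 0 = y.mat 0 0 :=
    Complex.ext (by unfold t u at *; linarith) (by simp [mat_diag_im])
  have h11 : x.mat 1 1 = y.mat 1 1 :=
    Complex.ext (by unfold t u at *; linarith) (by simp [mat_diag_im])
  have h01 : x.mat 0 1 = y.mat 0 1 := Complex.ext hv hw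
  have h10 : x.mat 1 0 = y.mat 1 0 := by rw [mat_one_zero, mat_one_zero, h01]
  ext i j
  fin_cases i <;> fin_cases j <;> assumption

/-- The orthogonal complement of a point of the hyperboloid is negative definite. -/
theorem neg_of_orthogonal (y : H3) {a b c d : ℝ}
    (h : a * y.t - b * y.u - c * y.v - d * y.w = 0) : a ^ 2 ≤ b ^ 2 + c ^ 2 + d ^ 2 := by
  have hy := coord_eq y
  have h1 : (a * y.t) ^ 2 ≤ (b ^ 2 + c ^ 2 + d ^ 2) * (y.u ^ 2 + y.v ^ 2 + y.w ^ 2) := by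
    have : a * y.t = b * y.u + c * y.v + d * y.w := by linarith
    rw [this]
    nlinarith [sq_nonneg (b * y.v - c * y.u), sq_nonneg (b * y.w - d * y.u),
      sq_nonneg (c * y.w - d * y.v)]
  have h2 : a ^ 2 * y.t ^ 2 ≤ (b ^ 2 + c ^ 2 + d ^ 2) * y.t ^ 2 := by
    nlinarith [sq_nonneg b, sq_nonneg c, sq_nonneg d]
  exact le_of_mul_le_mul_right h2 (by have := t_pos y; positivity)

theorem form_self (x : H3) : form x x = 1 := by
  rw [form_eq]; linarith [coord_eq x]

theorem form_comm (x y : H3) : form x y = form y x := by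
  rw [form_eq, form_eq]; ring

theorem form_mul_bound (x y z : H3) :
    (form x z - form x y * form y z) ^ 2 ≤ (form x y ^ 2 - 1) * (form y z ^ 2 - 1) := by
  have hx := coord_eq x
  have hy := coord_eq y
  have hz := coord_eq z
  obtain ⟨a, ha⟩ : ∃ a, a = form x y := ⟨_, rfl⟩
  obtain ⟨b, hb⟩ : ∃ b, b = form y z := ⟨_, rfl⟩
  obtain ⟨c, hc⟩ : ∃ c, c = form x z := ⟨_, rfl⟩
  rw [← ha, ← hb, ← hc]
  rw [form_eq] at ha hb hc
  have key : ∀ s : ℝ, 0 ≤ (b ^ 2 - 1) * (s * s) + (-(2 * (c - a * b))) * s + (a ^ 2 - 1) := by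
    intro s
    have h := neg_of_orthogonal y
      (a := (x.t - a * y.t) + s * (z.t - b * y.t)) (b := (x.u - a * y.u) + s * (z.u - b * y.u))
      (c := (x.v - a * y.v) + s * (z.v - b * y.v)) (d := (x.w - a * y.w) + s * (z.w - b * y.w))
      (by linear_combination (-a - s * b) * hy - ha - s * hb)
    have e : (b ^ 2 - 1) * (s * s) + (-(2 * (c - a * b))) * s + (a ^ 2 - 1) =
        ((x.u - a * y.u) + s * (z.u - b * y.u)) ^ 2 + ((x.v - a * y.v) + s * (z.v - b * y.v)) ^ 2
        + ((x.w - a * y.w) + s * (z.w - b * y.w)) ^ 2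
        - ((x.t - a * y.t) + s * (z.t - b * y.t)) ^ 2 := by
      linear_combination hx + (a + s * b) ^ 2 * hy + s ^ 2 * hz + 2 * (a + s * b) * ha
        + 2 * s * (a + s * b) * hb - 2 * s * hc
    linarith
  have hd := discrim_le_zero key
  unfold discrim at hd
  nlinarith

theorem one_le_form (x y : H3) : 1 ≤ form x y := by
  have hx := coord_eq x
  have hy := coord_eq y
  rw [form_eq]
  have hxt := t_pos x
  have hyt := t_pos y
  have cs : (x.u * y.u + x.v * y.v + x.w * y.w) ^ 2 ≤ (x.t ^ 2 - 1) * (y.t ^ 2 - 1) := by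
    have h1 : x.t ^ 2 - 1 = x.u ^ 2 + x.v ^ 2 + x.w ^ 2 := by linarith
    have h2 : y.t ^ 2 - 1 = y.u ^ 2 + y.v ^ 2 + y.w ^ 2 := by linarith
    rw [h1, h2]
    nlinarith [sq_nonneg (x.u * y.v - x.v * y.u), sq_nonneg (x.u * y.w - x.w * y.u),
      sq_nonneg (x.v * y.w - x.w * y.v)]
  have hx1 : 1 ≤ x.t := by nlinarith [sq_nonneg x.u, sq_nonneg x.v, sq_nonneg x.w]
  have hy1 : 1 ≤ y.t := by nlinarith [sq_nonneg y.u, sq_nonneg y.v, sq_nonneg y.w]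
  have h3 : (x.t ^ 2 - 1) * (y.t ^ 2 - 1) ≤ (x.t * y.t - 1) ^ 2 := by
    nlinarith [sq_nonneg (x.t - y.t)]
  have h4 : 0 ≤ x.t * y.t - 1 := by nlinarith
  have := abs_le_of_sq_le_sq' (cs.trans h3) h4
  linarith [this.2]

theorem eq_of_form_eq_one {x y : H3} (h : form x y = 1) : x = y := by
  have hx := coord_eq x
  have hy := coord_eq y
  have h' := h
  rw [form_eq] at h
  have hyt := t_pos y
  have o : (x.t - y.t) * y.t - (x.u - y.u) * y.u - (x.v - y.v) * y.v - (x.w - y.w) * y.w = 0 := by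
    linarith
  have nul : (x.t - y.t) ^ 2 = (x.u - y.u) ^ 2 + (x.v - y.v) ^ 2 + (x.w - y.w) ^ 2 := by
    linarith
  have e : (x.t - y.t) * y.t = (x.u - y.u) * y.u + (x.v - y.v) * y.v + (x.w - y.w) * y.w := by
    linarith
  have cs : ((x.t - y.t) * y.t) ^ 2 ≤ (x.t - y.t) ^ 2 * (y.t ^ 2 - 1) := by
    have h2 : y.t ^ 2 - 1 = y.u ^ 2 + y.v ^ 2 + y.w ^ 2 := by linarith
    rw [e, nul, h2]
    nlinarith [sq_nonneg ((x.u - y.u) * y.v - (x.v - y.v) * y.u),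
      sq_nonneg ((x.u - y.u) * y.w - (x.w - y.w) * y.u),
      sq_nonneg ((x.v - y.v) * y.w - (x.w - y.w) * y.v)]
  have z : (x.t - y.t) ^ 2 = 0 := by nlinarith [sq_nonneg (x.t - y.t)]
  rw [z] at nul
  have zt := pow_eq_zero_iff (two_ne_zero) |>.mp z
  have zu : x.u - y.u = 0 := by
    refine pow_eq_zero_iff (two_ne_zero) |>.mp ?_
    nlinarith [sq_nonneg (x.u - y.u), sq_nonneg (x.v - y.v), sq_nonneg (x.w - y.w)]
  have zv : x.v - y.v = 0 := by
    refine pow_eq_zero_iff (two_ne_zero) |>.mp ?_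
    nlinarith [sq_nonneg (x.u - y.u), sq_nonneg (x.v - y.v), sq_nonneg (x.w - y.w)]
  have zw : x.w - y.w = 0 := by
    refine pow_eq_zero_iff (two_ne_zero) |>.mp ?_
    nlinarith [sq_nonneg (x.u - y.u), sq_nonneg (x.v - y.v), sq_nonneg (x.w - y.w)]
  exact coord_ext (sub_eq_zero.mp zt) (sub_eq_zero.mp zu) (sub_eq_zero.mp zv) (sub_eq_zero.mp zw)

theorem dist_triangle' (x y z : H3) : dist x z ≤ dist x y + dist y z := by
  have hxy := one_le_form x y
  have hyz := one_le_form y z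
  have hxz := one_le_form x z
  have nn : 0 ≤ dist x y + dist y z :=
    add_nonneg (Real.arcosh_nonneg hxy) (Real.arcosh_nonneg hyz)
  rw [← Real.arcosh_cosh nn, dist_def x z,
    Real.arcosh_le_arcosh (by linarith) (Real.cosh_pos _), Real.cosh_add, dist_def, dist_def,
    Real.cosh_arcosh hxy, Real.cosh_arcosh hyz, Real.sinh_arcosh hxy, Real.sinh_arcosh hyz,
    ← Real.sqrt_mul (by nlinarith)]
  have := Real.le_sqrt_of_sq_le (form_mul_bound x y z)
  linarith

instance : MetricSpace H3 where
  dist_self x := by rw [dist_def, form_self]; exact (Real.arcosh_eq_zero_iff le_rfl).mpr rfl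
  dist_comm x y := by rw [dist_def, dist_def, form_comm]
  dist_triangle := dist_triangle'
  eq_of_dist_eq_zero {x y} h := eq_of_form_eq_one ((Real.arcosh_eq_zero_iff (one_le_form x y)).mp h)

instance : MeasurableSpace H3 := borel H3
instance : BorelSpace H3 := ⟨rfl⟩

/-! ### The action of `PSL(2, ℂ)` by orientation-preserving isometries, `g • x = g x g*` -/

instance : MulAction SL(2, ℂ) H3 where
  smul g x :=
    { mat := g.1 * x.mat * (g.1)ᴴ
      posDef := (Matrix.IsUnit.posDef_star_right_conjugate_iff
        ((Matrix.isUnit_iff_isUnit_det _).mpr (by rw [g.2]; exact isUnit_one))).mpr x.posDef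
      det_eq_one := by
        rw [Matrix.det_mul, Matrix.det_mul, Matrix.det_conjTranspose, g.2, x.det_eq_one]; simp }
  one_smul x := H3.ext (by
    change (1 : Matrix (Fin 2) (Fin 2) ℂ) * x.mat * 1ᴴ = x.mat
    simp)
  mul_smul g h x := H3.ext (by
    change (g.1 * h.1) * x.mat * (g.1 * h.1)ᴴ = g.1 * (h.1 * x.mat * (h.1)ᴴ) * (g.1)ᴴ
    simp [Matrix.mul_assoc])

theorem sl_smul_mat (g : SL(2, ℂ)) (x : H3) : (g • x).mat = g.1 * x.mat * (g.1)ᴴ := rfl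

theorem center_smul {g : SL(2, ℂ)} (hg : g ∈ Subgroup.center SL(2, ℂ)) (x : H3) : g • x = x := by
  obtain ⟨r, hr, hs⟩ := Matrix.SpecialLinearGroup.mem_center_iff.mp hg
  have hr2 : r ^ 2 = 1 := by simpa using hr
  have hr3 : r * conj r = 1 := by
    rcases eq_or_eq_neg_of_sq_eq_sq r 1 (by rw [hr2, one_pow]) with rfl | rfl <;> simp
  apply H3.ext
  rw [sl_smul_mat, ← hs]
  ext i j
  simp [Matrix.scalar_apply]
  linear_combination (x.mat i j) * hr3

/-- The homomorphism from `PSL(2, ℂ)` to the permutations of hyperbolic 3-space. -/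
def pslToPerm : PSL(2, ℂ) →* Equiv.Perm H3 :=
  QuotientGroup.lift _ (MulAction.toPermHom SL(2, ℂ) H3)
    (fun _ hg => Equiv.ext fun x => center_smul hg x)

instance : MulAction PSL(2, ℂ) H3 := MulAction.compHom H3 pslToPerm

theorem psl_smul_mk (g : SL(2, ℂ)) (x : H3) : (QuotientGroup.mk g : PSL(2, ℂ)) • x = g • x := rfl

end H3

/-! ### Loxodromic and hyperbolic elements

The trace of an element of `PSL(2, ℂ)` is defined up to sign. -/

/-- The trace of `g` lies outside the real interval `[-2, 2]`. -/
def IsLoxodromic (g : PSL(2, ℂ)) : Prop :=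
  ∃ M : SL(2, ℂ), (QuotientGroup.mk M : PSL(2, ℂ)) = g ∧
    ¬ ∃ r : ℝ, r ∈ Set.Icc (-2 : ℝ) 2 ∧ M.1.trace = (r : ℂ)

/-- The trace of `g` is real and lies outside the interval `[-2, 2]`. -/
def IsHyperbolic (g : PSL(2, ℂ)) : Prop :=
  ∃ M : SL(2, ℂ), (QuotientGroup.mk M : PSL(2, ℂ)) = g ∧
    ∃ r : ℝ, r ∉ Set.Icc (-2 : ℝ) 2 ∧ M.1.trace = (r : ℂ)

/-- The axis of `g`: the points on a complete geodesic along which `g` acts as a translation by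
a positive distance (a loxodromic element has exactly one such geodesic). -/
def axis (g : PSL(2, ℂ)) : Set H3 :=
  {x | ∃ c : ℝ → H3, Isometry c ∧ x ∈ Set.range c ∧ ∃ τ : ℝ, 0 < τ ∧ ∀ s, g • c s = c (s + τ)}

/-! ### Lattices and arithmetic Kleinian groups -/

/-- A group with finite covolume on `H3`; the volume is the three-dimensional Hausdorff measure
of the hyperbolic metric. -/
def HasFiniteCovolume (Γ : Subgroup PSL(2, ℂ)) : Prop :=
  ∃ F : Set H3, IsFundamentalDomain Γ F (μH[3] : Measure H3) ∧ (μH[3] : Measure H3) F < ∞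

/-- A lattice in `PSL(2, ℂ)`: a discrete subgroup of finite covolume. -/
def IsLattice (Γ : Subgroup PSL(2, ℂ)) : Prop :=
  DiscreteTopology Γ ∧ HasFiniteCovolume Γ

section Quaternion

variable (k : Type) [Field k] [NumberField k] (B : Type) [Ring B] [Algebra k B]

/-- A quaternion algebra over `k`: a central simple algebra of dimension four. -/
structure IsQuaternionAlgebra : Prop where
  central : Algebra.IsCentral k B
  simple : IsSimpleRing B
  finrank_eq : Module.finrank k B = 4

/-- `B` ramifies at the real place given by `σ`: the base change of `B` along `σ : k → ℝ` is a
division algebra. -/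
def RamifiesAtReal (σ : k →+* ℝ) : Prop :=
  letI : Algebra k ℝ := σ.toAlgebra
  ∀ x : ℝ ⊗[k] B, x ≠ 0 → IsUnit x

/-- The type of identifications of the base change of `B` along `φ : k → ℂ` with `M₂(ℂ)`. -/
def Splitting (φ : k →+* ℂ) : Type :=
  letI : Algebra k ℂ := φ.toAlgebra
  (ℂ ⊗[k] B) ≃ₐ[ℂ] Matrix (Fin 2) (Fin 2) ℂ

variable {k B}

/-- The embedding of `B` into `M₂(ℂ)` given by an identification of its base change. -/
def Splitting.toMatrix {φ : k →+* ℂ} (e : Splitting k B φ) : B →+* Matrix (Fin 2) (Fin 2) ℂ :=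
  letI : Algebra k ℂ := φ.toAlgebra
  (AlgEquiv.toRingEquiv (R := ℂ) e : ℂ ⊗[k] B →+* Matrix (Fin 2) (Fin 2) ℂ).comp
    (Algebra.TensorProduct.includeRight : B →ₐ[k] ℂ ⊗[k] B).toRingHom

/-- An order of `B`: a subring containing `𝓞 k` which is finitely generated as an `𝓞 k`-module and
spans `B` over `k`. -/
def IsOrder (O : Subalgebra (𝓞 k) B) : Prop :=
  (Subalgebra.toSubmodule O).FG ∧ Submodule.span k (O : Set B) = ⊤

/-- A maximal order of `B`. -/
def IsMaximalOrder (O : Subalgebra (𝓞 k) B) : Prop :=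
  Maximal IsOrder O

/-- The image in `PSL(2, ℂ)` of the group `O¹` of units of `O` of reduced norm one. The reduced
norm of `b` is the determinant of its image in `M₂(ℂ)`, so a unit has reduced norm one exactly
when its image lies in `SL(2, ℂ)`. -/
def normOneImage {φ : k →+* ℂ} (e : Splitting k B φ) (O : Subalgebra (𝓞 k) B) :
    Subgroup PSL(2, ℂ) where
  carrier := {g | ∃ (b : Oˣ) (M : SL(2, ℂ)),
    M.1 = e.toMatrix ((b : O) : B) ∧ (QuotientGroup.mk M : PSL(2, ℂ)) = g}
  one_mem' := ⟨1, 1, by simp, rfl⟩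
  mul_mem' := by
    rintro _ _ ⟨a, M, hM, rfl⟩ ⟨b, N, hN, rfl⟩
    exact ⟨a * b, M * N, by simp [hM, hN], rfl⟩
  inv_mem' := by
    rintro _ ⟨a, M, hM, rfl⟩
    refine ⟨a⁻¹, M⁻¹, ?_, rfl⟩
    have h1 : M.1 * e.toMatrix ((a⁻¹ : Oˣ) : O) = 1 := by
      rw [hM, ← map_mul, ← MulMemClass.coe_mul, Units.mul_inv]
      simp
    have h2 : (M⁻¹ : SL(2, ℂ)).1 * M.1 = 1 := congrArg Subtype.val (inv_mul_cancel M)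
    calc (M⁻¹ : SL(2, ℂ)).1 = (M⁻¹ : SL(2, ℂ)).1 * (M.1 * e.toMatrix ((a⁻¹ : Oˣ) : O)) := by
          rw [h1, mul_one]
      _ = _ := by rw [← mul_assoc, h2, one_mul]

end Quaternion

/-- An arithmetic Kleinian group: a lattice in `PSL(2, ℂ)` which is commensurable in the wide sense
(that is, after conjugation in `PSL(2, ℂ)`) with the image of `O¹`, for a maximal order `O` of a
quaternion algebra `B` over a number field `k` with exactly one complex place such that `B`
ramifies at all real places of `k`. The complex place is given by a non-real embedding `φ`. -/
def IsArithmeticKleinian (Γ : Subgroup PSL(2, ℂ)) : Prop :=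
  IsLattice Γ ∧
  ∃ (k : Type) (_ : Field k) (_ : NumberField k) (B : Type) (_ : Ring B) (_ : Algebra k B)
    (φ : k →+* ℂ) (e : Splitting k B φ) (O : Subalgebra (𝓞 k) B) (g : PSL(2, ℂ)),
    NumberField.InfinitePlace.nrComplexPlaces k = 1 ∧
    ¬ NumberField.ComplexEmbedding.IsReal φ ∧
    IsQuaternionAlgebra k B ∧
    (∀ σ : k →+* ℝ, RamifiesAtReal k B σ) ∧
    IsMaximalOrder O ∧
    Subgroup.Commensurable (ConjAct.toConjAct g • Γ) (normOneImage e O)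

/-! ### Totally geodesic surfaces in the quotient -/

/-- The quotient `H³/Γ`. -/
abbrev Orbifold (Γ : Subgroup PSL(2, ℂ)) : Type := MulAction.orbitRel.Quotient Γ H3

/-- The projection `H³ → H³/Γ`. -/
def proj (Γ : Subgroup PSL(2, ℂ)) (x : H3) : Orbifold Γ := Quotient.mk _ x

/-- Totally geodesic hyperplanes of `H³`: the intersections of the hyperboloid with the hyperplanes
`{x | tr (N x) = 0}` of Minkowski space that are orthogonal to a space-like vector. -/
def IsHyperplane (P : Set H3) : Prop :=
  ∃ N : Matrix (Fin 2) (Fin 2) ℂ, N.IsHermitian ∧ N.det.re < 0 ∧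
    P = {x | (N * x.mat).trace = 0}

/-- The surface `P / Stab_Γ(P)` has finite area; the area on `P` is the two-dimensional Hausdorff
measure of the hyperbolic metric. -/
def HasFiniteArea (Γ : Subgroup PSL(2, ℂ)) (P : Set H3) : Prop :=
  ∃ F : Set H3, IsFundamentalDomain (MulAction.stabilizer Γ P) F ((μH[2] : Measure H3).restrict P) ∧
    ((μH[2] : Measure H3).restrict P) F < ∞

/-- `S` is (the point set in `H³/Γ` of) a finite area totally geodesic surface of `H³/Γ`: the
image of a totally geodesic hyperplane `P` whose quotient `P / Stab_Γ(P)` has finite area. -/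
def IsFiniteAreaTotallyGeodesicSurface (Γ : Subgroup PSL(2, ℂ)) (S : Set (Orbifold Γ)) : Prop :=
  ∃ P : Set H3, IsHyperplane P ∧ HasFiniteArea Γ P ∧ S = proj Γ '' P

/-- The closed geodesic of `H³/Γ` associated to `γ`: the image of the axis of `γ`. -/
def associatedGeodesic (Γ : Subgroup PSL(2, ℂ)) (γ : PSL(2, ℂ)) : Set (Orbifold Γ) :=
  proj Γ '' axis γ

end HypGeod

end

/-! A geodesic lies over only countably many translates of the plane `P`, so uncountability of the
line forces one translate of `P` to contain two points of the axis of `γ`, hence all of it. After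
conjugation `γ` is `diag(a, a⁻¹)` and `P` is a plane through the geodesic of diagonal matrices; the
planes `γ ^ n • P` all pass through that geodesic, and `γ` rotates them by `2 arg a`. If these
planes were pairwise distinct, a ball centred on the axis would meet infinitely many translates of
`P` in equal positive area. Unfolding these areas to a fundamental domain of `P / Stab_Γ(P)`, where
the translates of the ball have bounded multiplicity, contradicts finite area. So some `γ ^ n`
fixes `P`, which means that `a ^ (2 * n)` is real and `γ ^ (2 * n)` is hyperbolic. -/

noncomputable section

namespace HypGeod

section Recurrence

theorem injective_stabilizer_mul_inv_pow {G X : Type*} [Group G] [MulAction G X] {x : X} {γ : G}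
    (hγ : ∀ n : ℕ, 1 ≤ n → γ ^ n • x ≠ x) :
    Function.Injective fun p : ℕ × MulAction.stabilizer G x => (p.2 : G) * (γ ^ p.1)⁻¹ := by
  have hsmul : ∀ p : ℕ × MulAction.stabilizer G x, ((p.2 : G) * (γ ^ p.1)⁻¹)⁻¹ • x = γ ^ p.1 • x :=
    fun p => by
      rw [_root_.mul_inv_rev, inv_inv, mul_smul, MulAction.mem_stabilizer_iff.mp (inv_mem p.2.2)]
  have hpow : Function.Injective fun n : ℕ => γ ^ n • x := by
    refine .of_lt_imp_ne fun m n hmn heq => hγ (n - m) (by omega) ?_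
    rw [← Nat.add_sub_of_le hmn.le, pow_add, mul_smul] at heq
    exact (smul_left_cancel _ heq).symm
  rintro ⟨m, g⟩ ⟨n, h⟩ heq
  dsimp only at heq
  obtain rfl : m = n := hpow <| by
    dsimp only
    rw [← hsmul (m, g), ← hsmul (n, h), heq]
  exact Prod.ext rfl (Subtype.ext (mul_right_cancel heq))

variable {G X : Type*} [Group G] [MulAction G X] [MeasurableSpace X]

theorem tsum_measure_le_of_encard_le {ι : Type*} [Countable ι] {ν : Measure X} {A : ι → Set X}
    (hA : ∀ i, MeasurableSet (A i)) {N : ℕ∞} (hN : ∀ x, {i | x ∈ A i}.encard ≤ N) :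
    ∑' i, ν (A i) ≤ N * ν Set.univ := by
  have hcount : ∀ x, ∑' i, (A i).indicator (1 : X → ℝ≥0∞) x = {i | x ∈ A i}.encard := fun x => by
    rw [← ENNReal.tsum_set_one, tsum_subtype {i | x ∈ A i} fun _ => (1 : ℝ≥0∞)]
    rfl
  calc ∑' i, ν (A i) = ∫⁻ x, ∑' i, (A i).indicator (1 : X → ℝ≥0∞) x ∂ν := by
        rw [lintegral_tsum fun i => (measurable_one.indicator (hA i)).aemeasurable]
        simp only [lintegral_indicator_one (hA _)]
    _ ≤ ∫⁻ _, N ∂ν := lintegral_mono fun x => by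
        rw [hcount]
        exact ENat.toENNReal_le.mpr (hN x)
    _ = N * ν Set.univ := lintegral_const _

theorem tsum_measure_smul_le [Countable G] [MeasurableConstSMul G X] (ν : Measure X) {U : Set X}
    (hU : MeasurableSet U) :
    ∑' g : G, ν (g • U) ≤ {g : G | (g • U ∩ U).Nonempty}.encard * ν Set.univ := by
  refine tsum_measure_le_of_encard_le (fun g => hU.const_smul g) fun x => ?_
  rcases Set.eq_empty_or_nonempty {g : G | x ∈ g • U} with hempty | ⟨g₀, hg₀⟩
  · simp only [hempty, Set.encard_empty, zero_le]
  · rw [← (mul_right_injective g₀⁻¹).encard_image]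
    refine Set.encard_le_encard ?_
    rintro _ ⟨g, hg, rfl⟩
    refine ⟨g₀⁻¹ • x, ?_, Set.mem_smul_set_iff_inv_smul_mem.mp hg₀⟩
    rw [mul_smul]
    exact Set.smul_mem_smul_set hg

theorem smulInvariantMeasure_restrict_stabilizer [MeasurableConstSMul G X] (μ : Measure X)
    [SMulInvariantMeasure G X μ] (P : Set X) :
    SMulInvariantMeasure (MulAction.stabilizer G P) X (μ.restrict P) := by
  refine ⟨fun g s hs => ?_⟩
  have hgP : (g • · : X → X) ⁻¹' P = P := by
    rw [Set.preimage_smul]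
    exact MulAction.mem_stabilizer_iff.mp g⁻¹.2
  have hgs : MeasurableSet ((g • · : X → X) ⁻¹' s) := measurable_const_smul (g : G) hs
  calc μ.restrict P ((g • ·) ⁻¹' s) = μ ((g • ·) ⁻¹' (s ∩ P)) := by
        rw [Measure.restrict_apply hgs, Set.preimage_inter, hgP]
    _ = μ (s ∩ P) := measure_preimage_smul μ (g : G) (s ∩ P)
    _ = μ.restrict P s := (Measure.restrict_apply hs).symm

-- If no power of `γ` fixes `P`, the elements `h γ⁻ⁿ` with `h` in the stabilizer of `P` are pairwise
-- distinct, so the total area of the sets `U ∩ γⁿ P` unfolds to a part of `∑ g, μ (P ∩ F ∩ g U)`.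
theorem exists_pow_smul_eq_of_tsum_measure_inter_smul_eq_top [Countable G]
    [MeasurableConstSMul G X] {μ : Measure X} [SMulInvariantMeasure G X μ] {P F U : Set X}
    (hF : IsFundamentalDomain (MulAction.stabilizer G P) F (μ.restrict P))
    (hFfin : μ.restrict P F < ∞) (hU : MeasurableSet U)
    (hUfin : {g : G | (g • U ∩ U).Nonempty}.Finite) {γ : G}
    (hγ : ∑' n : ℕ, μ (U ∩ γ ^ n • P) = ∞) : ∃ n : ℕ, 1 ≤ n ∧ γ ^ n • P = P := by
  by_contra! hne
  have := smulInvariantMeasure_restrict_stabilizer (G := G) μ P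
  set ν := (μ.restrict P).restrict F
  let f : ℕ × MulAction.stabilizer G P → G := fun p => p.2 * (γ ^ p.1)⁻¹
  have hunfold : ∀ n : ℕ, μ (U ∩ γ ^ n • P) = ∑' h, ν (f (n, h) • U) := fun n => by
    have hmeas := hU.const_smul (γ ^ n)⁻¹
    calc μ (U ∩ γ ^ n • P) = μ.restrict P ((γ ^ n)⁻¹ • U) := by
          rw [Measure.restrict_apply hmeas, ← measure_smul μ (γ ^ n)⁻¹, Set.smul_set_inter,
            inv_smul_smul]
      _ = ∑' h : MulAction.stabilizer G P, μ.restrict P (h • (γ ^ n)⁻¹ • U ∩ F) :=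
          hF.measure_eq_tsum _
      _ = ∑' h, ν (f (n, h) • U) := tsum_congr fun h => by
          rw [Measure.restrict_apply (hU.const_smul _), mul_smul]
          rfl
  refine absurd hγ (ne_of_lt ?_)
  calc ∑' n : ℕ, μ (U ∩ γ ^ n • P) = ∑' p, ν (f p • U) := by
        simp only [hunfold]
        exact ENNReal.tsum_prod.symm
    _ ≤ ∑' g : G, ν (g • U) :=
        ENNReal.tsum_comp_le_tsum_of_injective (injective_stabilizer_mul_inv_pow hne) fun g =>
          ν (g • U)
    _ ≤ {g : G | (g • U ∩ U).Nonempty}.encard * ν Set.univ := tsum_measure_smul_le _ hU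
    _ < ∞ := by
        rw [Measure.restrict_apply_univ, ← hUfin.cast_ncard_eq]
        exact ENNReal.mul_lt_top (ENNReal.natCast_lt_top _) hFfin

end Recurrence

namespace H3

theorem cosh_dist (x y : H3) : Real.cosh (dist x y) = form x y := by
  rw [dist_def, Real.cosh_arcosh (one_le_form x y)]

theorem form_smul (g : SL(2, ℂ)) (x y : H3) : form (g • x) (g • y) = form x y := by
  have hg : IsUnit g.1.det := by rw [g.2]; exact isUnit_one
  have hg' : IsUnit (g.1)ᴴ.det := by rw [det_conjTranspose, g.2, star_one]; exact isUnit_one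
  have hconj : (g • x).mat⁻¹ * (g • y).mat = (g.1)ᴴ⁻¹ * (x.mat⁻¹ * y.mat * (g.1)ᴴ) := by
    calc (g • x).mat⁻¹ * (g • y).mat
        = (g.1)ᴴ⁻¹ * (x.mat⁻¹ * (g.1⁻¹ * g.1) * y.mat * (g.1)ᴴ) := by
          simp only [sl_smul_mat, Matrix.mul_inv_rev, Matrix.mul_assoc]
      _ = (g.1)ᴴ⁻¹ * (x.mat⁻¹ * y.mat * (g.1)ᴴ) := by rw [nonsing_inv_mul _ hg, Matrix.mul_one]
  rw [form, hconj, trace_mul_comm, Matrix.mul_assoc, mul_nonsing_inv _ hg', Matrix.mul_one, form]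

instance : IsIsometricSMul SL(2, ℂ) H3 :=
  ⟨fun g => Isometry.of_dist_eq fun x y => by rw [dist_def, dist_def, form_smul]⟩

instance : IsIsometricSMul PSL(2, ℂ) H3 :=
  ⟨fun g => by
    induction g using QuotientGroup.induction_on with
    | H g => exact isometry_smul H3 g⟩

/-- The base point of hyperbolic space: the identity matrix. -/
def origin : H3 := ⟨1, PosDef.one, det_one⟩

theorem form_origin (x : H3) : form origin x = x.t := by
  simp [form, origin, t, trace_fin_two]

theorem form_origin_smul_origin (g : SL(2, ℂ)) :
    form origin (g • origin) = (∑ i, ∑ j, ‖g.1 i j‖ ^ 2) / 2 := by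
  simp [form, sl_smul_mat, origin, trace_fin_two, Matrix.mul_apply, Complex.mul_conj,
    Complex.sq_norm]

theorem sq_norm_entry_le (g : SL(2, ℂ)) (i j : Fin 2) :
    ‖g.1 i j‖ ^ 2 ≤ 2 * form origin (g • origin) := by
  calc ‖g.1 i j‖ ^ 2 ≤ ∑ j, ‖g.1 i j‖ ^ 2 :=
        Finset.single_le_sum (f := fun j => ‖g.1 i j‖ ^ 2) (fun _ _ => by positivity)
          (Finset.mem_univ j)
    _ ≤ ∑ i, ∑ j, ‖g.1 i j‖ ^ 2 :=
        Finset.single_le_sum (f := fun i => ∑ j, ‖g.1 i j‖ ^ 2) (fun _ _ => by positivity)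
          (Finset.mem_univ i)
    _ = 2 * form origin (g • origin) := by rw [form_origin_smul_origin]; ring

theorem isCompact_setOf_norm_entry_le (C : ℝ) :
    IsCompact {g : SL(2, ℂ) | ∀ i j, ‖g.1 i j‖ ≤ C} := by
  have hclosed : Topology.IsClosedEmbedding (Subtype.val : SL(2, ℂ) → Matrix (Fin 2) (Fin 2) ℂ) :=
    (isClosed_eq continuous_id.matrix_det continuous_const).isClosedEmbedding_subtypeVal
  let K : Set (Matrix (Fin 2) (Fin 2) ℂ) :=
    Set.univ.pi fun _ => Set.univ.pi fun _ => Metric.closedBall 0 C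
  have hK : IsCompact K :=
    isCompact_univ_pi fun _ => isCompact_univ_pi fun _ => isCompact_closedBall 0 C
  have hpre : {g : SL(2, ℂ) | ∀ i j, ‖g.1 i j‖ ≤ C} = Subtype.val ⁻¹' K :=
    Set.ext fun g => ⟨fun hg i _ j _ => mem_closedBall_zero_iff.mpr (hg i j),
      fun hg i j => mem_closedBall_zero_iff.mp (hg i trivial j trivial)⟩
  exact hpre ▸ hclosed.isCompact_preimage hK

end H3

instance : IsClosed (Subgroup.center SL(2, ℂ) : Set SL(2, ℂ)) := by
  rw [Subgroup.coe_center, ← Set.centralizer_univ]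
  exact Set.isClosed_centralizer _

instance : T2Space PSL(2, ℂ) :=
  have : T3Space (SL(2, ℂ) ⧸ Subgroup.center SL(2, ℂ)) := inferInstance
  inferInstanceAs (T2Space (SL(2, ℂ) ⧸ Subgroup.center SL(2, ℂ)))

section Discrete
variable (Γ : Subgroup PSL(2, ℂ)) [DiscreteTopology Γ]

theorem finite_setOf_dist_smul_le (x : H3) (R : ℝ) : {g : Γ | dist x (g • x) ≤ R}.Finite := by
  let K : Set SL(2, ℂ) := {g | ∀ i j, ‖g.1 i j‖ ≤ √(2 * Real.cosh (2 * dist H3.origin x + R))}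
  have hK : IsCompact ((QuotientGroup.mk : SL(2, ℂ) → PSL(2, ℂ)) '' K) :=
    (H3.isCompact_setOf_norm_entry_le _).image QuotientGroup.continuous_mk
  have hfin : {g : Γ | (g : PSL(2, ℂ)) ∈
      (QuotientGroup.mk : SL(2, ℂ) → PSL(2, ℂ)) '' K}.Finite := by
    simpa using! (Γ.tendsto_coe_cofinite_of_discrete ⟨inferInstance⟩) hK.compl_mem_cocompact
  refine hfin.subset ?_
  rintro ⟨g, hgΓ⟩ hg
  induction g using QuotientGroup.induction_on with
  | H g =>
    refine ⟨g, fun i j => Real.le_sqrt_of_sq_le ((H3.sq_norm_entry_le g i j).trans ?_), rfl⟩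
    change dist x (g • x) ≤ R at hg
    have hdist : dist H3.origin (g • H3.origin) ≤ 2 * dist H3.origin x + R := by
      have htri := dist_triangle4 H3.origin x (g • x) (g • H3.origin)
      rw [dist_smul, dist_comm x H3.origin] at htri
      linarith
    have hnonneg : 0 ≤ dist H3.origin (g • H3.origin) := dist_nonneg
    rw [← H3.cosh_dist]
    gcongr
    rwa [Real.cosh_le_cosh, abs_of_nonneg hnonneg, abs_of_nonneg (hnonneg.trans hdist)]

theorem finite_setOf_smul_ball_inter_ball_nonempty (x : H3) (r : ℝ) :
    {g : Γ | (g • Metric.ball x r ∩ Metric.ball x r).Nonempty}.Finite := by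
  refine (finite_setOf_dist_smul_le Γ x (2 * r)).subset ?_
  rintro ⟨g, hg⟩ ⟨_, ⟨y, hy, rfl⟩, hgy⟩
  change g • y ∈ Metric.ball x r at hgy
  change dist x (g • x) ≤ 2 * r
  have htri := dist_triangle_left x (g • x) (g • y)
  rw [dist_smul] at htri
  linarith [Metric.mem_ball.mp hy, Metric.mem_ball.mp hgy]

theorem countable_of_discreteTopology : Countable Γ := by
  rw [← Set.countable_univ_iff]
  have hunion : (Set.univ : Set Γ) = ⋃ n : ℕ, {g : Γ | dist H3.origin (g • H3.origin) ≤ n} := by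
    ext g
    simpa using exists_nat_ge _
  rw [hunion]
  exact Set.countable_iUnion fun n => (finite_setOf_dist_smul_le Γ H3.origin n).countable

end Discrete

theorem posDef_of_det_pos_of_trace_pos {M : Matrix (Fin 2) (Fin 2) ℂ} (hM : M.IsHermitian)
    (hdet : 0 < M.det) (htrace : 0 < M.trace) : M.PosDef := by
  rw [hM.det_eq_prod_eigenvalues, Fin.prod_univ_two, ← RCLike.ofReal_mul] at hdet
  rw [hM.trace_eq_sum_eigenvalues, Fin.sum_univ_two, ← RCLike.ofReal_add] at htrace
  have hprod : 0 < hM.eigenvalues 0 * hM.eigenvalues 1 := Complex.zero_lt_real.mp hdet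
  have hsum : 0 < hM.eigenvalues 0 + hM.eigenvalues 1 := Complex.zero_lt_real.mp htrace
  rw [hM.posDef_iff_eigenvalues_pos, Fin.forall_fin_two]
  rcases pos_and_pos_or_neg_and_neg_of_mul_pos hprod with hpos | hneg
  · exact hpos
  · linarith

namespace H3

/-- The point of the hyperboloid over the space-like coordinates `u = p` and `v + i w = z`. -/
def ofCoord (p : ℝ) (z : ℂ) : H3 :=
  let M : Matrix (Fin 2) (Fin 2) ℂ := !![((√(1 + p ^ 2 + ‖z‖ ^ 2) + p : ℝ) : ℂ), z;
    conj z, ((√(1 + p ^ 2 + ‖z‖ ^ 2) - p : ℝ) : ℂ)]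
  have hdet : M.det = 1 := by
    have hnonneg : 0 ≤ 1 + p ^ 2 + ‖z‖ ^ 2 := by positivity
    rw [det_fin_two_of, Complex.mul_conj, ← Complex.sq_norm, ← Complex.ofReal_mul,
      ← Complex.ofReal_sub, Complex.ofReal_eq_one]
    linear_combination Real.sq_sqrt hnonneg
  have hherm : M.IsHermitian := by
    ext i j
    fin_cases i <;> fin_cases j <;> simp [M]
  have htrace : 0 < M.trace := by
    rw [trace_fin_two_of, ← Complex.ofReal_add, Complex.zero_lt_real, add_add_sub_cancel]
    positivity
  ⟨M, posDef_of_det_pos_of_trace_pos hherm (hdet ▸ one_pos) htrace, hdet⟩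

theorem t_ofCoord (p : ℝ) (z : ℂ) : (ofCoord p z).t = √(1 + p ^ 2 + ‖z‖ ^ 2) := by
  simp [t, ofCoord]

theorem u_ofCoord (p : ℝ) (z : ℂ) : (ofCoord p z).u = p := by
  simp [u, ofCoord]

theorem w_ofCoord (p : ℝ) (z : ℂ) : (ofCoord p z).w = z.im := by
  simp [w, ofCoord]

theorem mat_ofCoord_one_zero (p : ℝ) (z : ℂ) : (ofCoord p z).mat 1 0 = conj z := by
  simp [ofCoord]

end H3

section Diagonal
variable {K : Type*} [Field K]

/-- The diagonal matrix with entries `a` and `a⁻¹`. Over `ℂ` it translates along the geodesic of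
diagonal matrices by `2 log ‖a‖` and rotates around it by `2 arg a`. -/
def diagSL : Kˣ →* SL(2, K) where
  toFun a := ⟨diagonal ![(a : K), (a : K)⁻¹], by simp⟩
  map_one' := Subtype.ext <| by
    rw [← Matrix.ext_iff, Fin.forall_fin_two, Fin.forall_fin_two, Fin.forall_fin_two]
    simp
  map_mul' a b := Subtype.ext <| by
    change _ = diagonal ![(a : K), (a : K)⁻¹] * diagonal ![(b : K), (b : K)⁻¹]
    rw [diagonal_mul_diagonal, diagonal_eq_diagonal_iff, Fin.forall_fin_two]
    simp [mul_comm]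

theorem coe_diagSL (a : Kˣ) : (diagSL a).1 = diagonal ![(a : K), (a : K)⁻¹] := rfl

theorem hasEigenvalue_toLin'_of_add_inv_eq_trace {M : SL(2, K)} {a : K} (ha : a ≠ 0)
    (htrace : a + a⁻¹ = M.1.trace) : Module.End.HasEigenvalue (toLin' M.1) a := by
  rw [Module.End.hasEigenvalue_iff_isRoot_charpoly, charpoly_toLin', charpoly_fin_two,
    M.2, ← htrace]
  simp only [Polynomial.IsRoot.def, Polynomial.eval_add, Polynomial.eval_sub, Polynomial.eval_mul,
    Polynomial.eval_pow, Polynomial.eval_X, Polynomial.eval_C]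
  field_simp
  ring

theorem exists_eq_conj_diagSL {M : SL(2, K)} {a : Kˣ} (ha : (a : K) ≠ (a : K)⁻¹)
    (htrace : (a : K) + (a : K)⁻¹ = M.1.trace) : ∃ h : SL(2, K), M = h * diagSL a * h⁻¹ := by
  obtain ⟨v, hv⟩ :=
    (hasEigenvalue_toLin'_of_add_inv_eq_trace a.ne_zero htrace).exists_hasEigenvector
  obtain ⟨w, hw⟩ := (hasEigenvalue_toLin'_of_add_inv_eq_trace (inv_ne_zero a.ne_zero)
    (by rwa [inv_inv, add_comm])).exists_hasEigenvector
  have hindep : LinearIndependent K ![v, w] :=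
    Module.End.eigenvectors_linearIndependent' (toLin' M.1) ![(a : K), (a : K)⁻¹]
      (by simpa [Function.Injective, Fin.forall_fin_two] using ⟨ha, ha.symm⟩) _
      (Fin.forall_fin_two.mpr ⟨hv, hw⟩)
  let d : K := det (of ![v, w])
  have hd : d ≠ 0 := by
    rw [← isUnit_iff_ne_zero, ← isUnit_iff_isUnit_det]
    exact linearIndependent_rows_iff_isUnit.mp hindep
  let h : SL(2, K) := ⟨(of ![d⁻¹ • v, w])ᵀ, by
    calc (of ![d⁻¹ • v, w])ᵀ.det = d⁻¹ * d := by
          simp only [d, det_transpose, det_fin_two, of_apply, Matrix.cons_val_zero,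
            Matrix.cons_val_one, Pi.smul_apply, smul_eq_mul]
          ring
      _ = 1 := inv_mul_cancel₀ hd⟩
  have heigen : ∀ j, M.1 *ᵥ ![d⁻¹ • v, w] j = ![(a : K), (a : K)⁻¹] j • ![d⁻¹ • v, w] j :=
    Fin.forall_fin_two.mpr ⟨by
      rw [Matrix.cons_val_zero, Matrix.cons_val_zero, mulVec_smul, smul_comm (a : K)]
      exact congrArg (d⁻¹ • ·) hv.apply_eq_smul, hw.apply_eq_smul⟩
  refine ⟨h, eq_mul_inv_of_mul_eq (Subtype.ext (Matrix.ext fun i j => ?_))⟩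
  calc (M.1 * (of ![d⁻¹ • v, w])ᵀ) i j = (M.1 *ᵥ ![d⁻¹ • v, w] j) i := rfl
    _ = ((of ![d⁻¹ • v, w])ᵀ * diagonal ![(a : K), (a : K)⁻¹]) i j := by
        rw [heigen, mul_diagonal, Pi.smul_apply, smul_eq_mul, mul_comm]
        rfl

end Diagonal

namespace H3

/-- The unit speed geodesic of diagonal matrices. -/
def diagGeodesic (s : ℝ) : H3 where
  mat := diagonal ![(Real.exp s : ℂ), (Real.exp (-s) : ℂ)]
  posDef := by
    rw [posDef_diagonal_iff, Fin.forall_fin_two]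
    exact ⟨Complex.zero_lt_real.mpr (Real.exp_pos s), Complex.zero_lt_real.mpr (Real.exp_pos (-s))⟩
  det_eq_one := by
    rw [det_diagonal, Fin.prod_univ_two]
    simp [← Complex.exp_add]

theorem form_diagGeodesic (s s' : ℝ) :
    form (diagGeodesic s) (diagGeodesic s') = Real.cosh (s - s') := by
  rw [Real.cosh_sub, Real.cosh_eq, Real.cosh_eq, Real.sinh_eq, Real.sinh_eq]
  simp only [form_eq, t, u, v, w, diagGeodesic, diagonal_apply_eq, diagonal_apply_ne _ zero_ne_one,
    Matrix.cons_val_zero, Matrix.cons_val_one, Complex.ofReal_re, Complex.zero_re, Complex.zero_im]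
  ring

theorem isometry_diagGeodesic : Isometry diagGeodesic :=
  Isometry.of_dist_eq fun s s' => by
    rw [dist_def, form_diagGeodesic, ← Real.cosh_abs, Real.arcosh_cosh (abs_nonneg _),
      Real.dist_eq]

theorem diagSL_smul_diagGeodesic (a : ℂˣ) (s : ℝ) :
    diagSL a • diagGeodesic s = diagGeodesic (s + 2 * Real.log ‖(a : ℂ)‖) := by
  have hexp : Real.exp (2 * Real.log ‖(a : ℂ)‖) = ‖(a : ℂ)‖ ^ 2 := by
    rw [two_mul, Real.exp_add, Real.exp_log (norm_pos_iff.mpr a.ne_zero), sq]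
  apply H3.ext
  rw [sl_smul_mat, coe_diagSL, diagGeodesic, diagGeodesic, diagonal_conjTranspose,
    diagonal_mul_diagonal, diagonal_mul_diagonal, diagonal_eq_diagonal_iff, Fin.forall_fin_two,
    neg_add, Real.exp_add, Real.exp_add, Real.exp_neg (2 * _), hexp]
  simp only [Matrix.cons_val_zero, Matrix.cons_val_one, Pi.star_apply, RCLike.star_def, map_inv₀,
    Complex.ofReal_mul, Complex.ofReal_inv, Complex.sq_norm, ← Complex.mul_conj, _root_.mul_inv]
  constructor <;> ring

theorem smul_diagGeodesic_mem_axis (h : SL(2, ℂ)) {a : ℂˣ} (ha : 1 < ‖(a : ℂ)‖) (s : ℝ) :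
    h • diagGeodesic s ∈ axis (QuotientGroup.mk (h * diagSL a * h⁻¹) : PSL(2, ℂ)) := by
  refine ⟨fun s => h • diagGeodesic s, (isometry_smul H3 h).comp isometry_diagGeodesic,
    ⟨s, rfl⟩, 2 * Real.log ‖(a : ℂ)‖, mul_pos two_pos (Real.log_pos ha), fun s => ?_⟩
  rw [psl_smul_mk, mul_smul, mul_smul, inv_smul_smul, diagSL_smul_diagGeodesic]

theorem diagSL_smul_origin {a : ℂˣ} (ha : ‖(a : ℂ)‖ = 1) : diagSL a • origin = origin := by
  have horigin : origin = diagGeodesic 0 := H3.ext <| by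
    rw [← Matrix.ext_iff, Fin.forall_fin_two, Fin.forall_fin_two, Fin.forall_fin_two]
    simp [origin, diagGeodesic]
  rw [horigin, diagSL_smul_diagGeodesic, ha, Real.log_one, mul_zero, add_zero]

/-- The totally geodesic plane of all `x` with `Re (b x₁₀) = 0`. For `b ≠ 0` these are the planes
that contain the geodesic of diagonal matrices. -/
def axialPlane (b : ℂ) : Set H3 := {x | (b * x.mat 1 0).re = 0}

theorem mem_axialPlane {b : ℂ} {x : H3} : x ∈ axialPlane b ↔ (b * x.mat 1 0).re = 0 := Iff.rfl

theorem mat_diagSL_smul_one_zero (a : ℂˣ) (x : H3) :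
    (diagSL a • x).mat 1 0 = (a : ℂ)⁻¹ * conj (a : ℂ) * x.mat 1 0 := by
  rw [sl_smul_mat, coe_diagSL, diagonal_conjTranspose, mul_diagonal, diagonal_mul]
  simp only [Matrix.cons_val_zero, Matrix.cons_val_one, Pi.star_apply, RCLike.star_def]
  ring

theorem diagSL_smul_axialPlane (a : ℂˣ) (b : ℂ) :
    diagSL a • axialPlane b = axialPlane (b * (a / conj (a : ℂ))) := by
  ext x
  rw [Set.mem_smul_set_iff_inv_smul_mem, ← map_inv, mem_axialPlane, mem_axialPlane,
    mat_diagSL_smul_one_zero, Units.val_inv_eq_inv_val, inv_inv, map_inv₀, ← mul_assoc,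
    div_eq_mul_inv]

theorem axialPlane_real_mul {r : ℝ} (hr : r ≠ 0) (b : ℂ) : axialPlane (r * b) = axialPlane b := by
  ext x
  rw [mem_axialPlane, mem_axialPlane, mul_assoc, Complex.re_ofReal_mul, mul_eq_zero,
    or_iff_right hr]

theorem exists_axialPlane_eq_smul {b : ℂ} (hb : b ≠ 0) :
    ∃ c : ℂˣ, ‖(c : ℂ)‖ = 1 ∧ axialPlane b = diagSL c • axialPlane 1 := by
  obtain ⟨c, hc⟩ := IsAlgClosed.exists_pow_nat_eq (b / ‖b‖) two_pos
  have hnorm : ‖b‖ ≠ 0 := norm_ne_zero_iff.mpr hb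
  have hc_norm : ‖c‖ = 1 := by
    rw [← pow_eq_one_iff_of_nonneg (norm_nonneg c) two_ne_zero, ← norm_pow, hc, norm_div,
      Complex.norm_real, norm_norm, div_self hnorm]
  refine ⟨Units.mk0 c (norm_ne_zero_iff.mp (hc_norm ▸ one_ne_zero)), hc_norm, ?_⟩
  rw [diagSL_smul_axialPlane, one_mul, Units.val_mk0, ← Complex.inv_eq_conj hc_norm, div_inv_eq_mul,
    ← sq, hc, ← axialPlane_real_mul hnorm (b / _),
    mul_div_cancel₀ _ (Complex.ofReal_ne_zero.mpr hnorm)]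

theorem im_div_eq_zero_of_axialPlane_subset {b b' : ℂ} (hb : b ≠ 0)
    (h : axialPlane b ⊆ axialPlane b') : (b' / b).im = 0 := by
  have hmem : ofCoord 0 (conj (Complex.I / b)) ∈ axialPlane b := by
    rw [mem_axialPlane, mat_ofCoord_one_zero, Complex.conj_conj, mul_div_cancel₀ _ hb, Complex.I_re]
  have hmem' := mem_axialPlane.mp (h hmem)
  rwa [mat_ofCoord_one_zero, Complex.conj_conj, mul_div_left_comm, Complex.I_mul_re,
    neg_eq_zero] at hmem'

theorem exists_sq_eq_ofReal_of_diagSL_smul_axialPlane {b : ℂ} (hb : b ≠ 0) {a : ℂˣ}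
    (h : diagSL a • axialPlane b = axialPlane b) : ∃ r : ℝ, (a : ℂ) ^ 2 = r := by
  have him : ((a : ℂ) / conj (a : ℂ)).im = 0 := by
    rw [diagSL_smul_axialPlane] at h
    simpa only [mul_div_cancel_left₀ _ hb] using im_div_eq_zero_of_axialPlane_subset hb h.ge
  obtain ⟨r, hr⟩ := Complex.conj_eq_iff_real.mp (Complex.conj_eq_iff_im.mpr him)
  refine ⟨r * ‖(a : ℂ)‖ ^ 2, ?_⟩
  rw [Complex.ofReal_mul, ← hr, Complex.sq_norm, ← Complex.mul_conj]
  have := (map_ne_zero conj).mpr a.ne_zero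
  field_simp

theorem trace_mul_smul_mat (N : Matrix (Fin 2) (Fin 2) ℂ) (h : SL(2, ℂ)) (x : H3) :
    (N * (h • x).mat).trace = ((h.1)ᴴ * N * h.1 * x.mat).trace := by
  rw [sl_smul_mat, ← Matrix.mul_assoc, ← Matrix.mul_assoc, trace_mul_comm, ← Matrix.mul_assoc,
    ← Matrix.mul_assoc]

end H3

theorem IsHyperplane.smul {P : Set H3} (hP : IsHyperplane P) (h : SL(2, ℂ)) :
    IsHyperplane (h • P) := by
  obtain ⟨N, hN, hdet, rfl⟩ := hP
  refine ⟨_, isHermitian_conjTranspose_mul_mul (h⁻¹).1 hN, ?_, ?_⟩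
  · rwa [det_mul, det_mul, det_conjTranspose, (h⁻¹).2, star_one, one_mul, mul_one]
  · ext x
    rw [Set.mem_smul_set_iff_inv_smul_mem]
    exact (H3.trace_mul_smul_mat N h⁻¹ x).congr_left

theorem IsHyperplane.exists_eq_axialPlane {P : Set H3} (hP : IsHyperplane P) {s s' : ℝ}
    (hss : s ≠ s') (hs : H3.diagGeodesic s ∈ P) (hs' : H3.diagGeodesic s' ∈ P) :
    ∃ b : ℂ, b ≠ 0 ∧ P = H3.axialPlane b := by
  obtain ⟨N, hN, hdet, rfl⟩ := hP
  have hexp : ∀ r, H3.diagGeodesic r ∈ {x : H3 | (N * x.mat).trace = 0} →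
      N 0 0 * Real.exp r ^ 2 + N 1 1 = 0 := fun r hr => by
    have htrace : N 0 0 * Real.exp r + N 1 1 * (Real.exp r : ℂ)⁻¹ = 0 := by
      simpa [H3.diagGeodesic, trace_fin_two, Complex.exp_neg] using hr
    have hne : (Real.exp r : ℂ) ≠ 0 := Complex.ofReal_ne_zero.mpr (Real.exp_ne_zero r)
    field_simp at htrace
    rwa [mul_zero] at htrace
  have hne : (Real.exp s : ℂ) ^ 2 - Real.exp s' ^ 2 ≠ 0 := by
    rw [sub_ne_zero, ← Complex.ofReal_pow, ← Complex.ofReal_pow, ne_eq, Complex.ofReal_inj,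
      sq_eq_sq₀ (Real.exp_pos s).le (Real.exp_pos s').le]
    exact fun heq => hss (Real.exp_injective heq)
  have h00 : N 0 0 = 0 := (mul_eq_zero_iff_right hne).mp <| by
    linear_combination hexp s hs - hexp s' hs'
  have h11 : N 1 1 = 0 := by simpa only [h00, zero_mul, zero_add] using hexp s hs
  have h10 : N 1 0 = conj (N 0 1) := (hN.apply 1 0).symm
  refine ⟨N 0 1, fun h01 => ?_, Set.ext fun x => ?_⟩
  · simp [det_fin_two, h00, h01] at hdet
  · have htrace : (N * x.mat).trace = ((2 * (N 0 1 * x.mat 1 0).re : ℝ) : ℂ) := by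
      rw [← Complex.add_conj, map_mul, ← h10, H3.mat_one_zero, Complex.conj_conj, trace_fin_two,
        Matrix.mul_apply, Matrix.mul_apply, Fin.sum_univ_two, Fin.sum_univ_two, h00, h11,
        H3.mat_one_zero]
      ring
    change (N * x.mat).trace = 0 ↔ (N 0 1 * x.mat 1 0).re = 0
    rw [htrace, Complex.ofReal_eq_zero, mul_eq_zero, or_iff_right two_ne_zero]

theorem cosh_sub_one_le {x : ℝ} (hx : 0 ≤ x) : Real.cosh x - 1 ≤ x ^ 2 * Real.exp x / 2 := by
  have hle : 1 - Real.exp (-x) ≤ x := by linarith [Real.add_one_le_exp (-x)]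
  have hnonneg : 0 ≤ 1 - Real.exp (-x) := by simpa using hx
  calc Real.cosh x - 1 = (1 - Real.exp (-x)) ^ 2 * Real.exp x / 2 := by
        rw [Real.cosh_eq, Real.exp_neg]
        field_simp
        ring
    _ ≤ x ^ 2 * Real.exp x / 2 := by gcongr

namespace H3

theorem sq_coord_sub_le (x y : H3) :
    (x.u - y.u) ^ 2 + (x.v - y.v) ^ 2 + (x.w - y.w) ^ 2 ≤
      (form x y - 1) * (x.t + y.t) ^ 2 / 2 := by
  have hx := coord_eq x
  have hy := coord_eq y
  have hform := form_eq x y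
  set S := (x.u - y.u) ^ 2 + (x.v - y.v) ^ 2 + (x.w - y.w) ^ 2
  have hcauchy : ((x.u - y.u) * (x.u + y.u) + (x.v - y.v) * (x.v + y.v) +
      (x.w - y.w) * (x.w + y.w)) ^ 2 ≤
      S * ((x.u + y.u) ^ 2 + (x.v + y.v) ^ 2 + (x.w + y.w) ^ 2) := by
    simpa only [Fin.sum_univ_three, Matrix.cons_val] using
      Finset.sum_mul_sq_le_sq_mul_sq Finset.univ ![x.u - y.u, x.v - y.v, x.w - y.w]
        ![x.u + y.u, x.v + y.v, x.w + y.w]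
  have hdiff : 2 * (form x y - 1) = S - (x.t - y.t) ^ 2 := by
    linear_combination 2 * hform + hx + hy
  have hsum : (x.u + y.u) ^ 2 + (x.v + y.v) ^ 2 + (x.w + y.w) ^ 2 ≤ (x.t + y.t) ^ 2 - 4 := by
    linarith [one_le_form x y]
  have hinner : (x.u - y.u) * (x.u + y.u) + (x.v - y.v) * (x.v + y.v) +
      (x.w - y.w) * (x.w + y.w) = (x.t - y.t) * (x.t + y.t) := by
    linear_combination hy - hx
  have : 0 ≤ S := by positivity
  have hbound : ((x.t - y.t) * (x.t + y.t)) ^ 2 ≤ S * ((x.t + y.t) ^ 2 - 4) :=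
    hinner ▸ hcauchy.trans (by gcongr)
  linear_combination (1 / 4 : ℝ) * hbound - (1 / 4 : ℝ) * (x.t + y.t) ^ 2 * hdiff

theorem mem_ball_origin_iff {x : H3} {r : ℝ} (hr : 0 ≤ r) :
    x ∈ Metric.ball origin r ↔ x.t < Real.cosh r := by
  rw [Metric.mem_ball', ← form_origin, ← cosh_dist, Real.cosh_lt_cosh, abs_of_nonneg dist_nonneg,
    abs_of_nonneg hr]

theorem lipschitzOnWith_coord_ball {r : ℝ} (hr : 0 ≤ r) :
    LipschitzOnWith (Real.exp r * Real.cosh r).toNNReal (fun x => ![x.u, x.w])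
      (Metric.ball origin r) := by
  have hK : 0 ≤ Real.exp r * Real.cosh r := by positivity
  refine LipschitzOnWith.of_dist_le_mul fun x hx y hy => ?_
  rw [Real.coe_toNNReal _ hK]
  have hd : dist x y ≤ 2 * r := by
    have := dist_triangle_right x y origin
    have := Metric.mem_ball.mp hx
    have := Metric.mem_ball.mp hy
    linarith
  have hxt := (mem_ball_origin_iff hr).mp hx
  have hyt := (mem_ball_origin_iff hr).mp hy
  have hnonneg : 0 ≤ x.t + y.t := (add_pos x.t_pos y.t_pos).le
  have hbound : (x.u - y.u) ^ 2 + (x.v - y.v) ^ 2 + (x.w - y.w) ^ 2 ≤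
      (Real.exp r * Real.cosh r * dist x y) ^ 2 := by
    calc _ ≤ (Real.cosh (dist x y) - 1) * (x.t + y.t) ^ 2 / 2 :=
          cosh_dist x y ▸ sq_coord_sub_le x y
      _ ≤ (dist x y ^ 2 * Real.exp (2 * r) / 2) * (Real.cosh r + Real.cosh r) ^ 2 / 2 := by
          have := sub_nonneg.mpr (Real.one_le_cosh (dist x y))
          gcongr
          exact (cosh_sub_one_le dist_nonneg).trans (by gcongr)
      _ = _ := by rw [two_mul r, Real.exp_add]; ring
  rw [dist_pi_le_iff (by positivity), Fin.forall_fin_two]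
  constructor
  · refine abs_le_of_sq_le_sq ?_ (by positivity)
    change (x.u - y.u) ^ 2 ≤ _
    linarith [sq_nonneg (x.v - y.v), sq_nonneg (x.w - y.w)]
  · refine abs_le_of_sq_le_sq ?_ (by positivity)
    change (x.w - y.w) ^ 2 ≤ _
    linarith [sq_nonneg (x.u - y.u), sq_nonneg (x.v - y.v)]

theorem hausdorffMeasure_ball_origin_inter_axialPlane_one_pos {r : ℝ} (hr : 0 < r) :
    0 < (μH[2] : Measure H3) (Metric.ball origin r ∩ axialPlane 1) := by
  let U : Set (Fin 2 → ℝ) := {q | 1 + q 0 ^ 2 + q 1 ^ 2 < Real.cosh r ^ 2}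
  have hU : IsOpen U := isOpen_lt (by fun_prop) continuous_const
  have hzero : (0 : Fin 2 → ℝ) ∈ U := by
    have : 1 < Real.cosh r ^ 2 := one_lt_pow₀ (Real.one_lt_cosh.mpr hr.ne') two_ne_zero
    simpa [U] using this
  have himage : U ⊆ (fun x : H3 => ![x.u, x.w]) '' (Metric.ball origin r ∩ axialPlane 1) := by
    intro q hq
    refine ⟨ofCoord (q 0) (q 1 * Complex.I), ⟨?_, ?_⟩, ?_⟩
    · rw [mem_ball_origin_iff hr.le, t_ofCoord, Real.sqrt_lt' (Real.cosh_pos r)]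
      rwa [norm_mul, Complex.norm_I, mul_one, Complex.norm_real, Real.norm_eq_abs, sq_abs]
    · simp [mem_axialPlane, mat_ofCoord_one_zero]
    · ext i
      fin_cases i
      · exact u_ofCoord _ _
      · simp [w_ofCoord]
  have hpos : 0 < (μH[2] : Measure (Fin 2 → ℝ)) U := by
    have hvolume := hausdorffMeasure_pi_real (ι := Fin 2)
    rw [Fintype.card_fin, Nat.cast_ofNat] at hvolume
    rw [hvolume]
    exact hU.measure_pos _ ⟨0, hzero⟩
  have hlip := (lipschitzOnWith_coord_ball hr.le).mono
    (Set.inter_subset_left (t := axialPlane 1))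
  have hle := hlip.hausdorffMeasure_image_le zero_le_two
  exact (CanonicallyOrderedAdd.mul_pos.mp (hpos.trans_le ((measure_mono himage).trans hle))).2

theorem hausdorffMeasure_ball_origin_inter_axialPlane {b : ℂ} (hb : b ≠ 0) (r : ℝ) :
    (μH[2] : Measure H3) (Metric.ball origin r ∩ axialPlane b) =
      (μH[2] : Measure H3) (Metric.ball origin r ∩ axialPlane 1) := by
  obtain ⟨c, hc, hbc⟩ := exists_axialPlane_eq_smul hb
  have hball : Metric.ball origin r = diagSL c • Metric.ball origin r := by
    rw [Metric.smul_ball, diagSL_smul_origin hc]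
  rw [hbc, hball, ← Set.smul_set_inter, measure_smul, ← hball]

end H3

theorem exists_one_lt_norm_and_add_inv_eq {z : ℂ}
    (hz : ¬ ∃ r : ℝ, r ∈ Set.Icc (-2 : ℝ) 2 ∧ z = (r : ℂ)) :
    ∃ a : ℂˣ, 1 < ‖(a : ℂ)‖ ∧ (a : ℂ) + (a : ℂ)⁻¹ = z := by
  obtain ⟨s, hs⟩ := IsAlgClosed.exists_pow_nat_eq (z ^ 2 - 4) two_pos
  have hmul : ((z + s) / 2) * ((z - s) / 2) = 1 := by linear_combination -hs / 4
  lift (z + s) / 2 to ℂˣ using IsUnit.of_mul_eq_one _ hmul with a ha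
  have hsum : (a : ℂ) + (a : ℂ)⁻¹ = z := by
    rw [inv_eq_of_mul_eq_one_right hmul, ha]
    ring
  rcases lt_trichotomy 1 ‖(a : ℂ)‖ with hgt | heq | hlt
  · exact ⟨a, hgt, hsum⟩
  · refine absurd ⟨2 * (a : ℂ).re, ?_, ?_⟩ hz
    · have hre := abs_le.mp (heq ▸ Complex.abs_re_le_norm (a : ℂ))
      constructor <;> linarith
    · rw [← hsum, Complex.inv_eq_conj heq.symm, Complex.add_conj]
  · refine ⟨a⁻¹, ?_, ?_⟩
    · rw [Units.val_inv_eq_inv_val, norm_inv]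
      exact (one_lt_inv₀ (norm_pos_iff.mpr a.ne_zero)).mpr hlt
    · rw [Units.val_inv_eq_inv_val, inv_inv, add_comm, hsum]

theorem IsLoxodromic.exists_eq_mk_conj_diagSL {γ : PSL(2, ℂ)} (hγ : IsLoxodromic γ) :
    ∃ (h : SL(2, ℂ)) (a : ℂˣ), 1 < ‖(a : ℂ)‖ ∧ γ = QuotientGroup.mk (h * diagSL a * h⁻¹) := by
  obtain ⟨M, rfl, hM⟩ := hγ
  obtain ⟨a, ha, hsum⟩ := exists_one_lt_norm_and_add_inv_eq hM
  have hne : (a : ℂ) ≠ (a : ℂ)⁻¹ := fun heq => by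
    have hnorm := congrArg norm heq
    rw [norm_inv] at hnorm
    exact (inv_lt_one_of_one_lt₀ ha).not_ge (hnorm ▸ ha.le)
  obtain ⟨h, rfl⟩ := exists_eq_conj_diagSL hne hsum
  exact ⟨h, a, ha, rfl⟩

theorem two_lt_abs_add_inv {r : ℝ} (hr : 1 < |r|) : 2 < |r + r⁻¹| := by
  have hr0 : r ≠ 0 := abs_pos.mp (one_pos.trans hr)
  have hmul : |r + r⁻¹| * |r| = |r| ^ 2 + 1 := by
    rw [← abs_mul, add_mul, inv_mul_cancel₀ hr0, ← sq, sq_abs, abs_of_pos (by positivity)]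
  refine lt_of_mul_lt_mul_right ?_ (abs_nonneg r)
  linarith [sq_pos_of_pos (sub_pos.mpr hr)]

theorem isHyperbolic_mk_conj_diagSL (h : SL(2, ℂ)) {a : ℂˣ} (ha : 1 < ‖(a : ℂ)‖) {r : ℝ}
    (hr : (a : ℂ) = r) : IsHyperbolic (QuotientGroup.mk (h * diagSL a * h⁻¹) : PSL(2, ℂ)) := by
  refine ⟨_, rfl, r + r⁻¹, fun hmem => ?_, ?_⟩
  · rw [hr, Complex.norm_real, Real.norm_eq_abs] at ha
    exact (two_lt_abs_add_inv ha).not_ge (abs_le.mpr hmem)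
  · have htrace : (h.1 * (diagSL a).1 * (h⁻¹).1).trace = (diagSL a).1.trace := by
      have hinv : (h⁻¹).1 * h.1 = 1 := congrArg Subtype.val (inv_mul_cancel h)
      rw [trace_mul_comm, ← Matrix.mul_assoc, hinv, Matrix.one_mul]
    change (h.1 * (diagSL a).1 * (h⁻¹).1).trace = _
    rw [htrace, coe_diagSL, trace_diagonal, Fin.sum_univ_two, Complex.ofReal_add,
      Complex.ofReal_inv, ← hr]
    rfl

section FiniteAreaSurface
variable {Γ : Subgroup PSL(2, ℂ)}

theorem mk_conj_diagSL_pow (h : SL(2, ℂ)) (a : ℂˣ) (n : ℕ) :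
    (QuotientGroup.mk (h * diagSL a * h⁻¹) : PSL(2, ℂ)) ^ n =
      QuotientGroup.mk (h * diagSL (a ^ n) * h⁻¹) := by
  rw [map_pow, ← conj_pow]
  rfl

theorem mk_conj_diagSL_pow_smul (h : SL(2, ℂ)) (a : ℂˣ) (n : ℕ) (P : Set H3) :
    (QuotientGroup.mk (h * diagSL a * h⁻¹) : PSL(2, ℂ)) ^ n • h • P =
      h • diagSL (a ^ n) • P := by
  rw [mk_conj_diagSL_pow]
  change (h * diagSL (a ^ n) * h⁻¹) • h • P = _
  rw [mul_smul, mul_smul, inv_smul_smul]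

theorem hausdorffMeasure_ball_inter_mk_conj_diagSL_pow_smul (h : SL(2, ℂ)) (a : ℂˣ) {b : ℂ}
    (hb : b ≠ 0) (r : ℝ) (n : ℕ) :
    (μH[2] : Measure H3) (Metric.ball (h • H3.origin) r ∩
      (QuotientGroup.mk (h * diagSL a * h⁻¹) : PSL(2, ℂ)) ^ n • h • H3.axialPlane b) =
      (μH[2] : Measure H3) (Metric.ball H3.origin r ∩ H3.axialPlane 1) := by
  have hne : (a ^ n : ℂˣ) / conj ((a ^ n : ℂˣ) : ℂ) ≠ 0 :=
    div_ne_zero (a ^ n).ne_zero ((map_ne_zero conj).mpr (a ^ n).ne_zero)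
  rw [mk_conj_diagSL_pow_smul, ← Metric.smul_ball, ← Set.smul_set_inter, measure_smul,
    H3.diagSL_smul_axialPlane,
    H3.hausdorffMeasure_ball_origin_inter_axialPlane (mul_ne_zero hb hne)]

theorem exists_pow_eq_ofReal_of_hasFiniteArea [DiscreteTopology Γ] {h : SL(2, ℂ)} {a : ℂˣ}
    {b : ℂ} (hb : b ≠ 0) (harea : HasFiniteArea Γ (h • H3.axialPlane b))
    (hΓ : (QuotientGroup.mk (h * diagSL a * h⁻¹) : PSL(2, ℂ)) ∈ Γ) :
    ∃ n : ℕ, 1 ≤ n ∧ ∃ r : ℝ, (a : ℂ) ^ n = r := by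
  have := countable_of_discreteTopology Γ
  obtain ⟨F, hF, hFfin⟩ := harea
  obtain ⟨n, hn, hnP⟩ := exists_pow_smul_eq_of_tsum_measure_inter_smul_eq_top (γ := ⟨_, hΓ⟩)
    hF hFfin Metric.isOpen_ball.measurableSet
    (finite_setOf_smul_ball_inter_ball_nonempty Γ (h • H3.origin) 1) <| by
      refine (tsum_congr fun n =>
        hausdorffMeasure_ball_inter_mk_conj_diagSL_pow_smul h a hb 1 n).trans ?_
      exact ENNReal.tsum_const_eq_top_of_ne_zero
        (H3.hausdorffMeasure_ball_origin_inter_axialPlane_one_pos one_pos).ne'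
  have hfix : h • diagSL (a ^ n) • H3.axialPlane b = h • H3.axialPlane b :=
    (mk_conj_diagSL_pow_smul h a n _).symm.trans hnP
  obtain ⟨r, hr⟩ :=
    H3.exists_sq_eq_ofReal_of_diagSL_smul_axialPlane hb (smul_left_cancel h hfix)
  exact ⟨n * 2, by omega, r, by rw [pow_mul, ← hr, Units.val_pow_eq_pow_val]⟩

theorem exists_smul_mem_of_proj_mem {P : Set H3} {x : H3} (hx : proj Γ x ∈ proj Γ '' P) :
    ∃ g : Γ, g • x ∈ P := by
  obtain ⟨_, hy, hyx⟩ := hx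
  obtain ⟨g, rfl⟩ := MulAction.orbitRel_apply.mp (Quotient.exact hyx)
  exact ⟨g, hy⟩

theorem exists_ne_mk_smul_mem_of_proj_mem [Countable Γ] {ι : Type*} [Uncountable ι] {c : ι → H3}
    {P : Set H3} (hc : ∀ i, proj Γ (c i) ∈ proj Γ '' P) :
    ∃ A : SL(2, ℂ), (QuotientGroup.mk A : PSL(2, ℂ)) ∈ Γ ∧
      ∃ i j, i ≠ j ∧ A • c i ∈ P ∧ A • c j ∈ P := by
  choose f hf using fun i => exists_smul_mem_of_proj_mem (hc i)
  obtain ⟨i, j, hfij, hij⟩ : ∃ i j, f i = f j ∧ i ≠ j := by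
    by_contra! hinj
    exact not_countable (Function.Injective.countable (f := f) hinj)
  obtain ⟨A, hA⟩ := QuotientGroup.mk_surjective (f i : PSL(2, ℂ))
  have hsmul : ∀ x : H3, A • x = f i • x := fun x => by
    rw [← H3.psl_smul_mk, hA]
    rfl
  exact ⟨A, hA ▸ (f i).2, i, j, hij, by rw [hsmul]; exact hf i, by rw [hsmul, hfij]; exact hf j⟩

theorem exists_conj_mem_of_associatedGeodesic_subset [Countable Γ] {h : SL(2, ℂ)} {a : ℂˣ}
    (ha : 1 < ‖(a : ℂ)‖) (hΓ : (QuotientGroup.mk (h * diagSL a * h⁻¹) : PSL(2, ℂ)) ∈ Γ)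
    {P : Set H3} (hP : IsHyperplane P)
    (hsub : associatedGeodesic Γ (QuotientGroup.mk (h * diagSL a * h⁻¹)) ⊆ proj Γ '' P) :
    ∃ (k : SL(2, ℂ)) (b : ℂ), b ≠ 0 ∧ P = k • H3.axialPlane b ∧
      (QuotientGroup.mk (k * diagSL a * k⁻¹) : PSL(2, ℂ)) ∈ Γ := by
  obtain ⟨A, hA, s, s', hss, hs, hs'⟩ :=
    exists_ne_mk_smul_mem_of_proj_mem (c := fun s => h • H3.diagGeodesic s) fun s =>
      hsub ⟨_, H3.smul_diagGeodesic_mem_axis h ha s, rfl⟩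
  rw [← mul_smul, ← Set.mem_inv_smul_set_iff] at hs hs'
  obtain ⟨b, hb, hPb⟩ := (hP.smul (A * h)⁻¹).exists_eq_axialPlane hss hs hs'
  refine ⟨A * h, b, hb, inv_smul_eq_iff.mp hPb, ?_⟩
  have hconj : A * h * diagSL a * (A * h)⁻¹ = A * (h * diagSL a * h⁻¹) * A⁻¹ := by group
  rw [hconj]
  exact Γ.mul_mem (Γ.mul_mem hA hΓ) (Γ.inv_mem hA)

end FiniteAreaSurface

end HypGeod

end

theorem mainTheorem6_general (Γ : Subgroup (Matrix.ProjectiveSpecialLinearGroup (Fin 2) ℂ))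
    [DiscreteTopology Γ] (γ : Matrix.ProjectiveSpecialLinearGroup (Fin 2) ℂ) (hγ : γ ∈ Γ)
    (hlox : HypGeod.IsLoxodromic γ)
    (hpow : ¬ ∃ n : ℕ, 1 ≤ n ∧ HypGeod.IsHyperbolic (γ ^ n)) :
    ¬ ∃ S : Set (HypGeod.Orbifold Γ), HypGeod.IsFiniteAreaTotallyGeodesicSurface Γ S ∧
      HypGeod.associatedGeodesic Γ γ ⊆ S := by
  rintro ⟨_, ⟨P, hP, harea, rfl⟩, hsub⟩
  have := HypGeod.countable_of_discreteTopology Γ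
  obtain ⟨h, a, ha, rfl⟩ := hlox.exists_eq_mk_conj_diagSL
  obtain ⟨k, b, hb, rfl, hk⟩ :=
    HypGeod.exists_conj_mem_of_associatedGeodesic_subset ha hγ hP hsub
  obtain ⟨n, hn, r, hr⟩ := HypGeod.exists_pow_eq_ofReal_of_hasFiniteArea hb harea hk
  have han : 1 < ‖((a ^ n : ℂˣ) : ℂ)‖ := by
    rw [Units.val_pow_eq_pow_val, norm_pow]
    exact one_lt_pow₀ ha (Nat.one_le_iff_ne_zero.mp hn)
  refine hpow ⟨n, hn, ?_⟩
  rw [HypGeod.mk_conj_diagSL_pow]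
  exact HypGeod.isHyperbolic_mk_conj_diagSL h han (Units.val_pow_eq_pow_val a n ▸ hr)

theorem mainTheorem6 (Γ : Subgroup (Matrix.ProjectiveSpecialLinearGroup (Fin 2) ℂ))
    (hΓ : HypGeod.IsArithmeticKleinian Γ)
    (γ : Matrix.ProjectiveSpecialLinearGroup (Fin 2) ℂ) (hγ : γ ∈ Γ)
    (hlox : HypGeod.IsLoxodromic γ)
    (hpow : ¬ ∃ n : ℕ, 1 ≤ n ∧ HypGeod.IsHyperbolic (γ ^ n)) :
    ¬ ∃ S : Set (HypGeod.Orbifold Γ), HypGeod.IsFiniteAreaTotallyGeodesicSurface Γ S ∧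
      HypGeod.associatedGeodesic Γ γ ⊆ S := by
  have := hΓ.1.1
  exact mainTheorem6_general Γ γ hγ hlox hpow
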